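/- Write $\widetilde H_k(X)$ for reduced singular homology with integer coefficients, that is, the kernel of the map $H_k(X)\to H_k(\mathrm{pt})$ induced by $X\to\mathrm{pt}$. For an integer $k\ge 0$, a subset $X\subset\mathbb{R}^n$ is called $k$-convex if for every $(k+1)$-dimensional affine subspace $L$ of $\mathbb{R}^n$ the map $\widetilde H_k(L\cap X)\to\widetilde H_k(X)$ induced by the inclusion is injective. A collection $S$ of affine subspaces of $\mathbb{R}^n$ is called locally finite if at most finitely many members of $S$ meet any given compact subset of $\mathbb{R}^n$. Lemma. Let $n,k\ge 0$ be integers and let $S$ be a locally finite (finite or infinite) collection of affine subspaces of $\mathbb{R}^n$, each of codimension $k+1$. Then the complement $\mathbb{R}^n\smallsetminus\bigcup_{M\in S}M$ is $k$-convex. -/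

import Mathlib

open CategoryTheory

noncomputable section

namespace HigherConvexity

/-- Singular homology in degree `k` with integer coefficients. -/
abbrev homology (k : ℕ) : TopCat.{0} ⥤ ModuleCat.{0} ℤ :=
  (AlgebraicTopology.singularHomologyFunctor (ModuleCat.{0} ℤ) k).obj (ModuleCat.of ℤ ℤ)

/-- The map from a space to a one-point space. -/
def toPoint (X : TopCat.{0}) : X ⟶ TopCat.of PUnit.{1} :=
  TopCat.ofHom (ContinuousMap.const X PUnit.unit)

/-- Reduced homology: the kernel of the map `H_k(X) → H_k(pt)` induced by `X → pt`. -/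
def reducedHomology (k : ℕ) (X : TopCat.{0}) : Submodule ℤ ((homology k).obj X) :=
  LinearMap.ker ((homology k).map (toPoint X)).hom

theorem map_mem_reducedHomology (k : ℕ) {X Y : TopCat.{0}} (f : X ⟶ Y) :
    ∀ c ∈ reducedHomology k X, ((homology k).map f).hom c ∈ reducedHomology k Y := by
  intro c hc
  have h : f ≫ toPoint Y = toPoint X := rfl
  have hc' : ((homology k).map (f ≫ toPoint Y)).hom c = 0 := by
    rw [h]; exact hc
  rw [Functor.map_comp] at hc'
  exact hc'

/-- The map on reduced homology induced by a continuous map. -/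
def reducedHomologyMap (k : ℕ) {X Y : TopCat.{0}} (f : X ⟶ Y) :
    reducedHomology k X →ₗ[ℤ] reducedHomology k Y :=
  ((homology k).map f).hom.restrict (map_mem_reducedHomology k f)

/-- The inclusion of a subset into a larger subset, both with the subspace topology. -/
def inclusion {V : Type} [TopologicalSpace V] {A B : Set V} (h : A ⊆ B) :
    TopCat.of A ⟶ TopCat.of B :=
  TopCat.ofHom ⟨Set.inclusion h, continuous_inclusion h⟩

/-- `X` is `k`-convex: for every `(k+1)`-dimensional affine subspace `L`, the inclusion
`L ∩ X → X` is injective on reduced homology in degree `k`. (A subspace `L` as below is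
nonempty, since the direction of the empty subspace has dimension `0`.) -/
def IsKConvex {V : Type} [AddCommGroup V] [Module ℝ V] [TopologicalSpace V]
    (k : ℕ) (X : Set V) : Prop :=
  ∀ L : AffineSubspace ℝ V, Module.finrank ℝ L.direction = k + 1 →
    Function.Injective
      (reducedHomologyMap k (inclusion (Set.inter_subset_right : (L : Set V) ∩ X ⊆ X)))

/-- `M` is a nonempty affine subspace of codimension `d`. -/
def HasCodim {V : Type} [AddCommGroup V] [Module ℝ V]
    (M : AffineSubspace ℝ V) (d : ℕ) : Prop :=
  (M : Set V).Nonempty ∧ Module.finrank ℝ (V ⧸ M.direction) = d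

/-- A collection of affine subspaces is locally finite if at most finitely many of its
members meet any given compact set. -/
def IsLocallyFinite {V : Type} [AddCommGroup V] [Module ℝ V] [TopologicalSpace V]
    (S : Set (AffineSubspace ℝ V)) : Prop :=
  ∀ K : Set V, IsCompact K → {M ∈ S | ((M : Set V) ∩ K).Nonempty}.Finite

end HigherConvexity

end

open CategoryTheory

noncomputable section

namespace HigherConvexity

/-! Reduced classes are represented by cycles of augmented singular chains. Let c be a k-cycle in L
∖ ⋃S that bounds in the complement of ⋃S. Its support is compact, so it lies in an open ball U, and
only finitely many members of S meet the closed ball. It is enough to bound c in L ∩ U off these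
members.

For a single M (`bounds_inter_compl`) there are three cases. If L ∩ U misses M, a cone bounds c. If
L and M share a point and their directions meet nontrivially, then M ∩ L has codimension at most k
in L, and its complement has no reduced homology in degree k. Otherwise L and M are complementary
and meet in one point; projecting along M sends the chain that bounds c off M into L ∖ M.

Several members are handled by Mayer–Vietoris (`bounds_inter`): a k-cycle in an intersection that
bounds in both open pieces bounds in the intersection, provided the union has no homology in degree
k + 1. The union of two complements is again the complement of a finite arrangement, and inside a
convex part of the (k + 1)-dimensional L such a complement is acyclic from degree k + 1 on
(`acyclic_inter_compl_biUnion`). This rests on covering the complement of a subspace of codimension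
d by d + 1 open half-spaces. Barycentric subdivision supplies Mayer–Vietoris. -/

/-- The standard simplex with `j` vertices. For `j = 0` it is empty. -/
abbrev Splx (j : ℕ) := stdSimplex ℝ (Fin j)

instance : IsEmpty (Splx 0) := by
  rw [Splx, stdSimplex_of_isEmpty_index]; infer_instance

/-- The inclusion of the face opposite to the vertex `i`. -/
def face {j : ℕ} (i : Fin (j + 1)) : C(Splx j, Splx (j + 1)) :=
  ⟨stdSimplex.map i.succAbove, stdSimplex.continuous_map _⟩

/-- Augmented singular chains, indexed by the number of vertices. -/
abbrev Chain (j : ℕ) (X : Type) [TopologicalSpace X] := C(Splx j, X) →₀ ℤ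

/-! ### Augmented singular chains -/

section basics
variable {X Y Z : Type} [TopologicalSpace X] [TopologicalSpace Y] [TopologicalSpace Z]

/-- The generator of the chain group given by a singular simplex. -/
def gen {j : ℕ} (σ : C(Splx j, X)) : Chain j X := Finsupp.single σ 1

theorem chain_hom_ext {j : ℕ} {M : Type*} [AddCommGroup M] {f g : Chain j X →ₗ[ℤ] M}
    (h : ∀ σ, f (gen σ) = g (gen σ)) : f = g :=
  Finsupp.lhom_ext' fun σ => LinearMap.ext_ring (h σ)

/-- The linear extension of a map defined on singular simplices. -/
def extend {j : ℕ} {M : Type*} [AddCommGroup M] (f : C(Splx j, X) → M) : Chain j X →ₗ[ℤ] M :=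
  Finsupp.linearCombination ℤ f

@[simp] theorem extend_gen {j : ℕ} {M : Type*} [AddCommGroup M] (f : C(Splx j, X) → M)
    (σ : C(Splx j, X)) : extend f (gen σ) = f σ := by
  simp [extend, gen]

/-- The boundary map of the augmented singular chain complex. -/
def bd (j : ℕ) : Chain (j + 1) X →ₗ[ℤ] Chain j X :=
  extend fun σ => ∑ i : Fin (j + 1), (-1 : ℤ) ^ (i : ℕ) • gen (σ.comp (face i))

theorem bd_gen {j : ℕ} (σ : C(Splx (j + 1), X)) :
    bd j (gen σ) = ∑ i : Fin (j + 1), (-1 : ℤ) ^ (i : ℕ) • gen (σ.comp (face i)) :=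
  extend_gen _ _

/-- The map on chains induced by a continuous map. -/
def push (f : C(X, Y)) (j : ℕ) : Chain j X →ₗ[ℤ] Chain j Y :=
  extend fun σ => gen (f.comp σ)

@[simp] theorem push_gen (f : C(X, Y)) {j : ℕ} (σ : C(Splx j, X)) :
    push f j (gen σ) = gen (f.comp σ) :=
  extend_gen _ _

theorem push_push (f : C(X, Y)) (g : C(Y, Z)) {j : ℕ} (c : Chain j X) :
    push g j (push f j c) = push (g.comp f) j c := by
  have : push g j ∘ₗ push f j = push (g.comp f) j :=
    chain_hom_ext fun σ => by simp [ContinuousMap.comp_assoc]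
  exact LinearMap.congr_fun this c

theorem bd_push (f : C(X, Y)) {j : ℕ} (c : Chain (j + 1) X) :
    bd j (push f (j + 1) c) = push f j (bd j c) := by
  have : bd j ∘ₗ push f (j + 1) = push f j ∘ₗ bd j :=
    chain_hom_ext fun σ => by simp [bd_gen, ContinuousMap.comp_assoc]
  exact LinearMap.congr_fun this c

theorem push_eq_mapDomain (f : C(X, Y)) {j : ℕ} (c : Chain j X) :
    push f j c = Finsupp.mapDomain (fun σ => f.comp σ) c := by
  have : push f j = Finsupp.lmapDomain ℤ ℤ (fun σ => f.comp σ) :=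
    chain_hom_ext fun σ => by
      rw [push_gen]; simp [gen, Finsupp.mapDomain_single]
  rw [this]; rfl

/-- The hypothesis concerns composition with `f`, not `f` itself: for `j = 0` the simplex is empty,
and composition is injective even when `f` collapses `X` to a point. -/
theorem push_injective_of_comp (f : C(X, Y)) {j : ℕ}
    (hf : Function.Injective fun σ : C(Splx j, X) => f.comp σ) :
    Function.Injective (push f j) := by
  intro c d e
  rw [push_eq_mapDomain, push_eq_mapDomain] at e
  exact Finsupp.mapDomain_injective hf e

theorem push_injective (f : C(X, Y)) (hf : Function.Injective f) (j : ℕ) :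
    Function.Injective (push f j) :=
  push_injective_of_comp f fun _ _ e => ContinuousMap.ext fun x => hf (DFunLike.congr_fun e x)

theorem succAbove_succAbove_of_le {j : ℕ} (i : Fin (j + 1)) (l : Fin (j + 2)) (h : (l : ℕ) ≤ i)
    (x : Fin j) (hl : (l : ℕ) < j + 1) :
    l.succAbove (i.succAbove x) = i.succ.succAbove ((Fin.castLT l hl).succAbove x) := by
  grind [Fin.succAbove]

theorem face_face {j : ℕ} (i : Fin (j + 1)) (l : Fin (j + 2)) (h : (l : ℕ) ≤ i)
    (hl : (l : ℕ) < j + 1) :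
    (face l).comp (face i) = (face i.succ).comp (face (Fin.castLT l hl)) := by
  ext1 x
  simp only [face, ContinuousMap.comp_apply, ContinuousMap.coe_mk, stdSimplex.map_comp_apply]
  congr 1
  funext y
  exact succAbove_succAbove_of_le i l h y hl

theorem bd_bd {j : ℕ} (c : Chain (j + 2) X) : bd j (bd (j + 1) c) = 0 := by
  have : bd j ∘ₗ bd (j + 1) = (0 : Chain (j + 2) X →ₗ[ℤ] Chain j X) := by
    refine chain_hom_ext fun σ => ?_
    simp only [LinearMap.comp_apply, bd_gen, map_sum, map_zsmul, LinearMap.zero_apply,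
      Finset.smul_sum, smul_smul, ContinuousMap.comp_assoc, ← Finset.sum_product']
    let P := Fin (j + 2) × Fin (j + 1)
    let S : Finset P := {p : P | (p.1 : ℕ) ≤ (p.2 : ℕ)}
    rw [Finset.univ_product_univ, ← Finset.sum_add_sum_compl S, ← eq_neg_iff_add_eq_zero,
      ← Finset.sum_neg_distrib]
    -- The simplicial identity matches the faces (i, l) with i ≤ l to the faces (l + 1, i), which
    -- carry the opposite sign.
    let φ : ∀ p : P, p ∈ S → P := fun p hp =>
      (p.2.succ, Fin.castLT p.1 (lt_of_le_of_lt (Finset.mem_filter.mp hp).right p.2.is_lt))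
    apply Finset.sum_bij φ
    · intro p hp
      simp only [S, φ, Finset.compl_filter, Finset.mem_filter_univ, Fin.val_succ,
        Fin.val_castLT] at hp ⊢
      omega
    · rintro ⟨i, l⟩ hp ⟨i', l'⟩ hp' h
      have h₁ := congrArg (fun q => (q.1 : ℕ)) h
      have h₂ := congrArg (fun q => (q.2 : ℕ)) h
      simp only [φ, Fin.val_succ, Fin.val_castLT] at h₁ h₂
      exact Prod.ext (Fin.ext h₂) (Fin.ext (Nat.succ_injective h₁))
    · rintro ⟨i', l'⟩ hp
      simp only [S, Finset.compl_filter, Finset.mem_filter_univ, not_le] at hp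
      refine ⟨(Fin.castSucc l', i'.pred ?_), ?_, ?_⟩
      · rintro rfl
        simp at hp
      · simp only [S, Finset.mem_filter_univ, Fin.val_castSucc, Fin.val_pred]
        omega
      · simp [φ]
    · rintro ⟨i, l⟩ hp
      simp only [S, Finset.mem_filter_univ] at hp
      simp only [φ]
      rw [face_face l i hp (lt_of_le_of_lt hp l.is_lt), ← neg_smul]
      congr 1
      simp only [Fin.val_succ, Fin.val_castLT, pow_add, pow_one]
      ring
  exact LinearMap.congr_fun this c

end basics

theorem face_apply_self {j : ℕ} (i : Fin (j + 1)) (y : Splx j) : face i y i = 0 := by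
  simp [face, FunOnFinite.linearMap_apply_apply, Fin.succAbove_ne]

theorem face_apply_succAbove {j : ℕ} (i : Fin (j + 1)) (y : Splx j) (l : Fin j) :
    face i y (i.succAbove l) = y l := by
  simp [face, FunOnFinite.linearMap_apply_apply, Finset.filter_eq']

/-! ### Cones over singular simplices in convex sets -/

section cone
variable {F : Type} [NormedAddCommGroup F] [NormedSpace ℝ F]

/-- The coordinates of a point of a simplex other than the vertex `0`, projected from that
vertex to the opposite face. -/
def tail {j : ℕ} (x : Splx (j + 1)) (h : x 0 ≠ 1) : Splx j :=
  ⟨fun i => x i.succ / (1 - x 0), fun i => div_nonneg (x.2.1 _) (sub_nonneg.2 (stdSimplex.le_one x 0)),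
    by
      have hs := stdSimplex.sum_eq_one x
      rw [Fin.sum_univ_succ] at hs
      rw [← Finset.sum_div, div_eq_one_iff_eq (sub_ne_zero.2 h.symm)]
      linarith⟩

theorem tail_spec {j : ℕ} (x : Splx (j + 1)) (h : x 0 ≠ 1) (i : Fin j) :
    x i.succ = (1 - x 0) * tail x h i := by
  change _ = (1 - x 0) * (x i.succ / (1 - x 0))
  rw [mul_div_cancel₀]
  exact sub_ne_zero.2 h.symm

theorem tail_eq {j : ℕ} (x : Splx (j + 1)) (h : x 0 ≠ 1) (y : Splx j)
    (hy : ∀ i, x i.succ = (1 - x 0) * y i) : tail x h = y := by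
  ext i
  exact mul_left_cancel₀ (sub_ne_zero.2 h.symm) ((tail_spec x h i).symm.trans (hy i))

open Classical in
/-- The cone with apex `b` over a map from a simplex to a vector space. -/
def coneFun {j : ℕ} (b : F) (σ : Splx j → F) (x : Splx (j + 1)) : F :=
  if h : x 0 = 1 then b else x 0 • b + (1 - x 0) • σ (tail x h)

theorem coneFun_of_eq_one {j : ℕ} (b : F) (σ : Splx j → F) (x : Splx (j + 1)) (h : x 0 = 1) :
    coneFun b σ x = b := dif_pos h

theorem coneFun_eq {j : ℕ} (b : F) (σ : Splx j → F) (x : Splx (j + 1)) (y : Splx j)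
    (hy : ∀ i, x i.succ = (1 - x 0) * y i) :
    coneFun b σ x = x 0 • b + (1 - x 0) • σ y := by
  by_cases h : x 0 = 1
  · simp [coneFun_of_eq_one, h]
  · rw [coneFun, dif_neg h, tail_eq x h y hy]

theorem coneFun_mem {j : ℕ} {K : Set F} (hK : Convex ℝ K) {b : F} (hb : b ∈ K) {σ : Splx j → F}
    (hσ : ∀ y, σ y ∈ K) (x : Splx (j + 1)) : coneFun b σ x ∈ K := by
  by_cases h : x 0 = 1
  · rwa [coneFun_of_eq_one _ _ _ h]
  · rw [coneFun, dif_neg h]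
    exact hK hb (hσ _) (x.2.1 0) (sub_nonneg.2 (stdSimplex.le_one x 0)) (by ring)

theorem continuous_splx_apply {j : ℕ} (i : Fin j) : Continuous fun x : Splx j => x i :=
  (continuous_apply i).comp continuous_subtype_val

theorem continuous_coneFun {j : ℕ} (b : F) {σ : Splx j → F} (hσ : Continuous σ) :
    Continuous (coneFun b σ) := by
  rw [continuous_iff_continuousAt]
  intro x
  have h0 := continuous_splx_apply (0 : Fin (j + 1))
  by_cases h : x 0 = 1
  -- `tail` has no limit at the apex, but `σ` is bounded by compactness and enters with the factor
  -- `1 - y 0`, which tends to zero.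
  · obtain ⟨C, hC⟩ := (isCompact_range (hσ.sub continuous_const : Continuous
      fun y => σ y - b)).isBounded.exists_norm_le
    rw [ContinuousAt, coneFun_of_eq_one _ _ _ h, tendsto_iff_norm_sub_tendsto_zero]
    have hl : Filter.Tendsto (fun y : Splx (j + 1) => (1 - y 0) * C) (nhds x) (nhds 0) := by
      have hc : Continuous fun y : Splx (j + 1) => (1 - y 0) * C :=
        (continuous_const.sub h0).mul continuous_const
      simpa only [h, sub_self, zero_mul] using hc.tendsto x
    refine squeeze_zero (fun _ => norm_nonneg _) (fun y => ?_) hl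
    by_cases hy : y 0 = 1
    · simp [coneFun_of_eq_one, hy]
    · have hpos : 0 ≤ 1 - y 0 := sub_nonneg.2 (stdSimplex.le_one y 0)
      have : coneFun b σ y - b = (1 - y 0) • (σ (tail y hy) - b) := by
        rw [coneFun, dif_neg hy]; module
      rw [this, norm_smul, Real.norm_of_nonneg hpos]
      exact mul_le_mul_of_nonneg_left (hC _ ⟨_, rfl⟩) hpos
  · have ho : IsOpen {y : Splx (j + 1) | y 0 ≠ 1} := isOpen_ne_fun h0 continuous_const
    refine ContinuousOn.continuousAt (s := {y : Splx (j + 1) | y 0 ≠ 1}) ?_ (ho.mem_nhds h)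
    rw [continuousOn_iff_continuous_domRestrict]
    have ht : Continuous fun y : {y : Splx (j + 1) | y 0 ≠ 1} => tail y.1 y.2 := by
      refine Continuous.subtype_mk (continuous_pi fun i => ?_) _
      exact ((continuous_splx_apply _).comp continuous_subtype_val).div
        (continuous_const.sub (h0.comp continuous_subtype_val))
        fun y => sub_ne_zero.2 (Ne.symm y.2)
    have : Set.domRestrict {y : Splx (j + 1) | y 0 ≠ 1} (coneFun b σ) =
        fun y => y.1 0 • b + (1 - y.1 0) • σ (tail y.1 y.2) := by
      funext y
      rw [Set.domRestrict_apply, coneFun, dif_neg y.2]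
    rw [this]
    have h0' : Continuous fun y : {y : Splx (j + 1) | y 0 ≠ 1} => y.1 0 :=
      h0.comp continuous_subtype_val
    exact (h0'.smul continuous_const).add ((continuous_const.sub h0').smul (hσ.comp ht))

variable {K : Set F} (hK : Convex ℝ K) (b : K)

/-- The cone over a singular simplex in a convex set. -/
def coneSplx {j : ℕ} (σ : C(Splx j, K)) : C(Splx (j + 1), K) :=
  ⟨fun x => ⟨coneFun (b : F) (fun y => (σ y : F)) x, coneFun_mem hK b.2 (fun y => (σ y).2) x⟩,
    (continuous_coneFun _ (continuous_subtype_val.comp σ.continuous)).subtype_mk _⟩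

theorem coneSplx_face_zero {j : ℕ} (σ : C(Splx j, K)) :
    (coneSplx hK b σ).comp (face 0) = σ := by
  ext y
  change coneFun (b : F) (fun y => (σ y : F)) (face 0 y) = _
  have h0 : face (0 : Fin (j + 1)) y 0 = 0 := face_apply_self 0 y
  rw [coneFun_eq _ _ _ y, h0]
  · simp
  · intro i
    rw [h0]
    simpa using face_apply_succAbove 0 y i

theorem coneSplx_face_succ {j : ℕ} (σ : C(Splx (j + 1), K)) (i : Fin (j + 1)) :
    (coneSplx hK b σ).comp (face i.succ) = coneSplx hK b (σ.comp (face i)) := by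
  ext x
  change coneFun (b : F) (fun y => (σ y : F)) (face i.succ x) =
    coneFun (b : F) (fun y => (σ (face i y) : F)) x
  have h0 : face i.succ x 0 = x 0 := by
    simpa using face_apply_succAbove i.succ x 0
  by_cases h : x 0 = 1
  · rw [coneFun_of_eq_one _ _ _ h, coneFun_of_eq_one _ _ _ (h0.trans h)]
  · rw [coneFun_eq _ _ x _ (tail_spec x h), coneFun_eq _ _ _ (face i (tail x h)), h0]
    intro l
    rw [h0]
    rcases Fin.eq_self_or_eq_succAbove i l with rfl | ⟨m, rfl⟩
    · rw [face_apply_self, face_apply_self, mul_zero]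
    · rw [← Fin.succ_succAbove_succ, face_apply_succAbove, face_apply_succAbove, tail_spec x h]

/-- The cone operator on singular chains of a convex set. -/
def cone (j : ℕ) : Chain j K →ₗ[ℤ] Chain (j + 1) K :=
  extend fun σ => gen (coneSplx hK b σ)

@[simp] theorem cone_gen {j : ℕ} (σ : C(Splx j, K)) :
    cone hK b j (gen σ) = gen (coneSplx hK b σ) := extend_gen _ _

theorem bd_cone_zero (c : Chain 0 K) : bd 0 (cone hK b 0 c) = c := by
  have : bd 0 ∘ₗ cone hK b 0 = LinearMap.id := chain_hom_ext fun σ => by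
    simp [bd_gen, coneSplx_face_zero]
  exact LinearMap.congr_fun this c

/-- Face 0 removes the apex and returns the base; each other face is the cone over a face of the
base, with its sign shifted by one. -/
theorem bd_cone {j : ℕ} (c : Chain (j + 1) K) :
    bd (j + 1) (cone hK b (j + 1) c) = c - cone hK b j (bd j c) := by
  have : bd (j + 1) ∘ₗ cone hK b (j + 1) = LinearMap.id - cone hK b j ∘ₗ bd j :=
    chain_hom_ext fun σ => by
      simp only [LinearMap.comp_apply, LinearMap.sub_apply, cone_gen, bd_gen, map_sum, map_zsmul,
        LinearMap.id_apply]
      rw [Fin.sum_univ_succ]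
      simp [coneSplx_face_zero, coneSplx_face_succ, pow_succ, sub_eq_add_neg]
  exact LinearMap.congr_fun this c

end cone

/-! ### Barycentric subdivision and its chain homotopy to the identity -/

section subdivision

/-- The barycenter of a simplex. -/
abbrev bary (j : ℕ) : Splx (j + 1) := stdSimplex.barycenter

/-- The barycentric subdivision of the identity simplex. -/
def sdId : ∀ j : ℕ, Chain j (Splx j)
  | 0 => gen (ContinuousMap.id _)
  | j + 1 => cone (convex_stdSimplex ℝ (Fin (j + 1))) (bary j) j
      (∑ i : Fin (j + 1), (-1 : ℤ) ^ (i : ℕ) • push (face i) j (sdId j))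

/-- The chain homotopy between the identity and the subdivision, on the identity simplex. -/
def htId : ∀ j : ℕ, Chain (j + 1) (Splx j)
  | 0 => 0
  | j + 1 => cone (convex_stdSimplex ℝ (Fin (j + 1))) (bary j) (j + 1)
      (gen (ContinuousMap.id _) -
        ∑ i : Fin (j + 1), (-1 : ℤ) ^ (i : ℕ) • push (face i) (j + 1) (htId j))

variable {X Y : Type} [TopologicalSpace X] [TopologicalSpace Y]

/-- Barycentric subdivision of singular chains. -/
def sd (j : ℕ) : Chain j X →ₗ[ℤ] Chain j X := extend fun σ => push σ j (sdId j)

/-- The chain homotopy between the identity and barycentric subdivision. -/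
def ht (j : ℕ) : Chain j X →ₗ[ℤ] Chain (j + 1) X := extend fun σ => push σ (j + 1) (htId j)

@[simp] theorem sd_gen {j : ℕ} (σ : C(Splx j, X)) : sd j (gen σ) = push σ j (sdId j) :=
  extend_gen _ _

@[simp] theorem ht_gen {j : ℕ} (σ : C(Splx j, X)) : ht j (gen σ) = push σ (j + 1) (htId j) :=
  extend_gen _ _

theorem sd_push (f : C(X, Y)) {j : ℕ} (c : Chain j X) : sd j (push f j c) = push f j (sd j c) := by
  have : sd j ∘ₗ push f j = push f j ∘ₗ sd j := chain_hom_ext fun σ => by simp [push_push]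
  exact LinearMap.congr_fun this c

theorem ht_push (f : C(X, Y)) {j : ℕ} (c : Chain j X) :
    ht j (push f j c) = push f (j + 1) (ht j c) := by
  have : ht j ∘ₗ push f j = push f (j + 1) ∘ₗ ht j := chain_hom_ext fun σ => by simp [push_push]
  exact LinearMap.congr_fun this c

theorem push_id {j : ℕ} (c : Chain j X) : push (ContinuousMap.id X) j c = c := by
  have : push (ContinuousMap.id X) j = LinearMap.id := chain_hom_ext fun σ => by simp
  exact LinearMap.congr_fun this c

theorem sd_bd_id (j : ℕ) : sd j (bd j (gen (ContinuousMap.id (Splx (j + 1))))) =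
    ∑ i : Fin (j + 1), (-1 : ℤ) ^ (i : ℕ) • push (face i) j (sdId j) := by
  simp [bd_gen]

theorem ht_bd_id (j : ℕ) : ht j (bd j (gen (ContinuousMap.id (Splx (j + 1))))) =
    ∑ i : Fin (j + 1), (-1 : ℤ) ^ (i : ℕ) • push (face i) (j + 1) (htId j) := by
  simp [bd_gen]

theorem sdId_succ (j : ℕ) : sdId (j + 1) = cone (convex_stdSimplex ℝ (Fin (j + 1))) (bary j) j
    (sd j (bd j (gen (ContinuousMap.id (Splx (j + 1)))))) := by
  rw [sd_bd_id]; rfl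

theorem htId_succ (j : ℕ) : htId (j + 1) = cone (convex_stdSimplex ℝ (Fin (j + 1))) (bary j) (j + 1)
    (gen (ContinuousMap.id _) - ht j (bd j (gen (ContinuousMap.id (Splx (j + 1)))))) := by
  rw [ht_bd_id]; rfl

theorem sd_zero (c : Chain 0 X) : sd 0 c = c := by
  have : (sd 0 : Chain 0 X →ₗ[ℤ] _) = LinearMap.id := chain_hom_ext fun σ => by simp [sdId]
  exact LinearMap.congr_fun this c

theorem ht_zero (c : Chain 0 X) : ht 0 c = 0 := by
  have : (ht 0 : Chain 0 X →ₗ[ℤ] _) = 0 := chain_hom_ext fun σ => by simp [htId]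
  exact LinearMap.congr_fun this c

theorem gen_eq_push {j : ℕ} (σ : C(Splx j, X)) : gen σ = push σ j (gen (ContinuousMap.id _)) := by
  simp

/-- By naturality only the identity simplex matters. There subdivision is the cone over sd ∂ id, and
the correction term in `bd_cone` vanishes because ∂ sd ∂ = sd ∂ ∂ = 0. -/
theorem bd_sd {j : ℕ} (c : Chain (j + 1) X) : bd j (sd (j + 1) c) = sd j (bd j c) := by
  induction j generalizing X with
  | zero =>
    have : bd 0 ∘ₗ sd 1 = sd 0 ∘ₗ (bd 0 : Chain 1 X →ₗ[ℤ] _) := chain_hom_ext fun σ => by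
      rw [LinearMap.comp_apply, LinearMap.comp_apply, gen_eq_push, sd_push, bd_push, bd_push,
        sd_push, sd_gen, push_id, sdId_succ, bd_cone_zero]
    exact LinearMap.congr_fun this c
  | succ j ih =>
    have : bd (j + 1) ∘ₗ sd (j + 2) = sd (j + 1) ∘ₗ (bd (j + 1) : Chain (j + 2) X →ₗ[ℤ] _) :=
      chain_hom_ext fun σ => by
        rw [LinearMap.comp_apply, LinearMap.comp_apply, gen_eq_push, sd_push, bd_push, bd_push,
          sd_push, sd_gen, push_id, sdId_succ, bd_cone, ih, bd_bd]
        simp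
    exact LinearMap.congr_fun this c

/-- Again by naturality on the identity simplex: the boundary of the cone over id - h ∂ id leaves,
by induction, the cone over sd ∂ id as correction term, and this is sd id. -/
theorem bd_ht {j : ℕ} (c : Chain (j + 1) X) :
    bd (j + 1) (ht (j + 1) c) = c - sd (j + 1) c - ht j (bd j c) := by
  induction j generalizing X with
  | zero =>
    have : bd 1 ∘ₗ ht 1 = LinearMap.id - sd 1 - ht 0 ∘ₗ (bd 0 : Chain 1 X →ₗ[ℤ] _) :=
      chain_hom_ext fun σ => by
        simp only [LinearMap.comp_apply, LinearMap.sub_apply, LinearMap.id_apply]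
        rw [gen_eq_push, ht_push, bd_push, sd_push, bd_push, ht_push, ← map_sub, ← map_sub]
        congr 1
        rw [ht_gen, push_id, htId_succ, bd_cone, map_sub, sd_gen, push_id, sdId_succ, ht_zero,
          sd_zero]
        simp
    exact LinearMap.congr_fun this c
  | succ j ih =>
    have : bd (j + 2) ∘ₗ ht (j + 2) =
        LinearMap.id - sd (j + 2) - ht (j + 1) ∘ₗ (bd (j + 1) : Chain (j + 2) X →ₗ[ℤ] _) :=
      chain_hom_ext fun σ => by
        simp only [LinearMap.comp_apply, LinearMap.sub_apply, LinearMap.id_apply]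
        rw [gen_eq_push, ht_push, bd_push, sd_push, bd_push, ht_push, ← map_sub, ← map_sub]
        congr 1
        rw [ht_gen, push_id, htId_succ, bd_cone, map_sub, ih, sd_gen, push_id, sdId_succ, bd_bd,
          map_zero, sub_zero, sub_sub_cancel, sub_right_comm]
    exact LinearMap.congr_fun this c

end subdivision

/-! ### Affine simplices and the shrinking of their edges -/

section mesh
variable {F : Type} [NormedAddCommGroup F] [NormedSpace ℝ F]

/-- The convex combination of the points `v i` with weights given by a point of the simplex. -/
def comb {j : ℕ} (v : Fin j → F) (x : Splx j) : F := ∑ i, x i • v i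

theorem comb_face {j : ℕ} (v : Fin (j + 1) → F) (i : Fin (j + 1)) (x : Splx j) :
    comb v (face i x) = comb (fun l => v (i.succAbove l)) x := by
  simp only [comb]
  rw [Fin.sum_univ_succAbove _ i, face_apply_self]
  simp [face_apply_succAbove]

/-- Both families of weights sum to one, so either combination can be averaged against the other.
Norm estimates then reduce to edge lengths. -/
theorem comb_sub {j : ℕ} (v : Fin j → F) (x y : Splx j) :
    comb v x - comb v y = ∑ a, ∑ b, (x a * y b) • (v a - v b) := by
  have h1 : ∀ a, ∑ b, (x a * y b) • v a = x a • v a := fun a => by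
    rw [← Finset.sum_smul, ← Finset.mul_sum, stdSimplex.sum_eq_one, mul_one]
  have h2 : ∀ b, ∑ a, (x a * y b) • v b = y b • v b := fun b => by
    rw [← Finset.sum_smul, ← Finset.sum_mul, stdSimplex.sum_eq_one, one_mul]
  simp only [smul_sub, Finset.sum_sub_distrib, h1]
  rw [Finset.sum_comm (f := fun a b => (x a * y b) • v b)]
  simp only [h2, comb]

theorem norm_comb_sub_le {j : ℕ} (v : Fin j → F) {d : ℝ} (hv : ∀ a b, ‖v a - v b‖ ≤ d)
    (x y : Splx j) : ‖comb v x - comb v y‖ ≤ d := by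
  rw [comb_sub]
  calc _ ≤ ∑ a, ∑ b, x a * y b * d := norm_sum_le_of_le _ fun a _ => norm_sum_le_of_le _ fun b _ => by
          have : 0 ≤ x a * y b := mul_nonneg (x.2.1 a) (y.2.1 b)
          rw [norm_smul, Real.norm_of_nonneg this]
          exact mul_le_mul_of_nonneg_left (hv a b) this
    _ = d := by
      simp only [← Finset.sum_mul, ← Finset.mul_sum, stdSimplex.sum_eq_one, one_mul, mul_one]

/-- In the double sum the diagonal terms vanish, so for each vertex only j of the j + 1 equal
barycentric weights contribute. -/
theorem norm_comb_bary_sub_le {j : ℕ} (v : Fin (j + 1) → F) {d : ℝ}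
    (hv : ∀ a b, ‖v a - v b‖ ≤ d) (y : Splx (j + 1)) :
    ‖comb v (bary j) - comb v y‖ ≤ j / (j + 1) * d := by
  have hb : ∀ a, bary j a = ((j : ℝ) + 1)⁻¹ := fun a => by
    change (stdSimplex.barycenter : Splx (j + 1)).val a = _
    simp
  have hj : (0 : ℝ) < j + 1 := by positivity
  rw [comb_sub, Finset.sum_comm]
  calc _ ≤ ∑ b : Fin (j + 1), y b * (j / (j + 1) * d) := norm_sum_le_of_le _ fun b _ => by
          rw [Fin.sum_univ_succAbove _ b, sub_self, smul_zero, zero_add]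
          calc _ ≤ ∑ i : Fin j, ((j : ℝ) + 1)⁻¹ * y b * d := norm_sum_le_of_le _ fun i _ => by
                  have : 0 ≤ ((j : ℝ) + 1)⁻¹ * y b := mul_nonneg (inv_nonneg.2 hj.le) (y.2.1 b)
                  rw [hb, norm_smul, Real.norm_of_nonneg this]
                  exact mul_le_mul_of_nonneg_left (hv _ _) this
            _ = _ := by
              rw [Finset.sum_const, Finset.card_univ, Fintype.card_fin, nsmul_eq_mul]
              field_simp
    _ = _ := by rw [← Finset.sum_mul, stdSimplex.sum_eq_one, one_mul]

theorem support_extend {j l : ℕ} {X Y : Type} [TopologicalSpace X] [TopologicalSpace Y]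
    (f : C(Splx j, X) → Chain l Y) (c : Chain j X) {τ : C(Splx l, Y)}
    (h : τ ∈ (extend f c).support) : ∃ σ ∈ c.support, τ ∈ (f σ).support := by
  classical
  rw [extend, Finsupp.linearCombination_apply, Finsupp.sum] at h
  obtain ⟨σ, hσ, hτ⟩ := Finset.mem_biUnion.1 (Finsupp.support_finsetSum h)
  exact ⟨σ, hσ, Finsupp.support_smul hτ⟩

theorem support_gen {j : ℕ} {X : Type} [TopologicalSpace X] {σ τ : C(Splx j, X)}
    (h : τ ∈ (gen σ).support) : τ = σ :=
  Finset.mem_singleton.1 (Finsupp.support_single_subset h)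

theorem support_push {j : ℕ} {X Y : Type} [TopologicalSpace X] [TopologicalSpace Y]
    (f : C(X, Y)) (c : Chain j X) {τ : C(Splx j, Y)} (h : τ ∈ (push f j c).support) :
    ∃ σ ∈ c.support, τ = f.comp σ := by
  obtain ⟨σ, hσ, hτ⟩ := support_extend _ c h
  exact ⟨σ, hσ, support_gen hτ⟩

/-- The simplices of the subdivision of the identity simplex are affine, and their edges are
shorter than those of the simplex by a fixed factor, in any affine realization. -/
theorem sdId_support (j : ℕ) {ρ : C(Splx (j + 1), Splx (j + 1))} (h : ρ ∈ (sdId (j + 1)).support) :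
    ∃ w : Fin (j + 1) → Splx (j + 1), (∀ x, (ρ x : Fin (j + 1) → ℝ) = comb (fun i => (w i).1) x) ∧
      ∀ (v : Fin (j + 1) → F) (d : ℝ), (∀ a b, ‖v a - v b‖ ≤ d) →
        ∀ i l, ‖comb v (w i) - comb v (w l)‖ ≤ j / (j + 1) * d := by
  classical
  have hcone : ∀ {j : ℕ} {ρ : C(Splx (j + 1), Splx (j + 1))}, ρ ∈ (sdId (j + 1)).support →
      ∃ i, ∃ ρ' ∈ (sdId j).support,
        ρ = coneSplx (convex_stdSimplex ℝ (Fin (j + 1))) (bary j) ((face i).comp ρ') := by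
    intro j ρ h
    obtain ⟨σ, hσ, hρ⟩ := support_extend _ _ h
    obtain ⟨i, -, hi⟩ := Finset.mem_biUnion.1 (Finsupp.support_finsetSum hσ)
    obtain ⟨ρ', h1, h2⟩ := support_push _ _ (Finsupp.support_smul hi)
    exact ⟨i, ρ', h1, h2 ▸ support_gen hρ⟩
  induction j with
  | zero =>
    obtain ⟨i, ρ', -, rfl⟩ := hcone h
    refine ⟨fun _ => bary 0, fun x => ?_, fun v d hv i l => ?_⟩
    · exact congrArg Subtype.val (Subsingleton.elim _ _ : _ = bary 0) |>.trans (by simp [comb])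
    · simp
  | succ j ih =>
    obtain ⟨i, ρ', hρ', rfl⟩ := hcone h
    obtain ⟨w, hw, hw'⟩ := ih hρ'
    refine ⟨Fin.cons (bary (j + 1)) fun l => face i (w l), fun x => ?_, fun v d hv => ?_⟩
    · have hface : ∀ y : Splx (j + 1), ((face i (ρ' y) : Splx (j + 2)) : Fin (j + 2) → ℝ) =
          comb (fun l => (face i (w l)).1) y := by
        intro y
        funext a
        simp only [comb, Finset.sum_apply, Pi.smul_apply, smul_eq_mul]
        change face i (ρ' y) a = ∑ l, y l * face i (w l) a
        rcases Fin.eq_self_or_eq_succAbove i a with rfl | ⟨m, rfl⟩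
        · simp [face_apply_self]
        · simp only [face_apply_succAbove]
          have := congrFun (hw y) m
          simp only [comb, Finset.sum_apply, Pi.smul_apply, smul_eq_mul] at this
          exact this
      change coneFun (bary (j + 1) : Fin (j + 2) → ℝ)
        (fun y => ((face i (ρ' y) : Splx (j + 2)) : Fin (j + 2) → ℝ)) x = _
      by_cases hx : x 0 = 1
      · have hz : ∀ l : Fin (j + 1), x l.succ = 0 := by
          have hs := stdSimplex.sum_eq_one x
          rw [Fin.sum_univ_succ, hx, add_eq_left] at hs
          exact fun l => (Finset.sum_eq_zero_iff_of_nonneg fun _ _ => x.2.1 _).1 hs l (Finset.mem_univ _)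
        rw [coneFun_of_eq_one _ _ _ hx, comb, Fin.sum_univ_succ]
        simp [hx, hz]
        rfl
      · rw [coneFun_eq _ _ x _ (tail_spec x hx), comb, Fin.sum_univ_succ]
        simp only [Fin.cons_zero, Fin.cons_succ]
        rw [hface, comb, Finset.smul_sum]
        simp only [smul_smul, ← tail_spec x hx]
        rfl
    · have hd : 0 ≤ d := (norm_nonneg _).trans (hv 0 0)
      push_cast
      have hmono : (j : ℝ) / (j + 1) * d ≤ (j + 1) / (j + 1 + 1) * d := by
        refine mul_le_mul_of_nonneg_right ?_ hd
        rw [div_le_div_iff₀ (by positivity) (by positivity)]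
        nlinarith
      have hbary := norm_comb_bary_sub_le v hv
      push_cast at hbary
      intro a b
      refine Fin.cases ?_ (fun a => ?_) a <;> refine Fin.cases ?_ (fun b => ?_) b
      · simp only [sub_self, norm_zero]
        positivity
      · exact hbary _
      · rw [norm_sub_rev]
        exact hbary _
      · simp only [Fin.cons_succ, comb_face]
        -- The inductive hypothesis is applied to the vertices of the `i`-th face; this is why the
        -- estimate is quantified over all `v`.
        exact (hw' _ d (fun _ _ => hv _ _) a b).trans hmono

/-- A singular simplex in a vector space is affine with edges of length at most `d`. -/
def AffineMesh {K : Set F} {j : ℕ} (d : ℝ) (τ : C(Splx j, K)) : Prop :=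
  ∃ v : Fin j → F, (∀ x, (τ x : F) = comb v x) ∧ ∀ a b, ‖v a - v b‖ ≤ d

theorem AffineMesh.norm_sub_le {K : Set F} {j : ℕ} {d : ℝ} {τ : C(Splx j, K)}
    (h : AffineMesh d τ) (x y : Splx j) : ‖(τ x : F) - τ y‖ ≤ d := by
  obtain ⟨v, hv, hd⟩ := h
  rw [hv, hv]
  exact norm_comb_sub_le v hd x y

theorem comb_comb {j l : ℕ} (v : Fin j → F) (w : Fin l → Splx j) (p : Splx j) (x : Splx l)
    (h : (p : Fin j → ℝ) = comb (fun i => (w i).1) x) :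
    comb v p = comb (fun i => comb v (w i)) x := by
  have : ∀ a, p a = ∑ i, x i * w i a := fun a => by
    have := congrFun h a
    simp only [comb, Finset.sum_apply, Pi.smul_apply, smul_eq_mul] at this
    exact this
  simp only [comb, this, Finset.sum_smul, Finset.smul_sum, smul_smul]
  exact Finset.sum_comm

theorem AffineMesh.sd {K : Set F} {j : ℕ} {d : ℝ} {c : Chain (j + 1) K}
    (hc : ∀ σ ∈ c.support, AffineMesh d σ) :
    ∀ τ ∈ (sd (j + 1) c).support, AffineMesh (j / (j + 1) * d) τ := by
  intro τ hτ
  obtain ⟨σ, hσ, h⟩ := support_extend _ c hτ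
  obtain ⟨ρ, hρ, rfl⟩ := support_push _ _ h
  obtain ⟨v, hv, hd⟩ := hc σ hσ
  obtain ⟨w, hw, hw'⟩ := sdId_support (F := F) j hρ
  refine ⟨fun i => comb v (w i), fun x => ?_, hw' v d hd⟩
  rw [ContinuousMap.comp_apply, hv]
  exact comb_comb v w _ x (hw x)

theorem affineMesh_id (j : ℕ) : AffineMesh 1 (ContinuousMap.id (Splx j)) := by
  refine ⟨fun i => Pi.single i 1, fun x => ?_, fun a b => ?_⟩
  · funext a
    simp only [comb, Finset.sum_apply, Pi.smul_apply, Pi.single_apply, smul_eq_mul, mul_ite,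
      mul_one, mul_zero, Finset.sum_ite_eq, Finset.mem_univ, if_true]
    rfl
  · rw [pi_norm_le_iff_of_nonneg zero_le_one]
    intro i
    simp only [Pi.sub_apply, Pi.single_apply]
    split_ifs <;> simp

theorem affineMesh_sd_iterate (j N : ℕ) :
    ∀ τ ∈ ((sd (j + 1))^[N] (gen (ContinuousMap.id (Splx (j + 1))))).support,
      AffineMesh (((j : ℝ) / (j + 1)) ^ N) τ := by
  induction N with
  | zero =>
    intro τ hτ
    rw [support_gen hτ, pow_zero]
    exact affineMesh_id _
  | succ N ih =>
    rw [Function.iterate_succ_apply', pow_succ']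
    exact AffineMesh.sd ih

end mesh

/-! ### Subdivision subordinate to an open cover -/

section small
variable {X : Type} [TopologicalSpace X]

theorem sd_iterate_push {Y : Type} [TopologicalSpace Y] (f : C(X, Y)) {j : ℕ} (N : ℕ)
    (c : Chain j X) : (sd j)^[N] (push f j c) = push f j ((sd j)^[N] c) := by
  induction N with
  | zero => rfl
  | succ N ih => rw [Function.iterate_succ_apply', ih, sd_push, Function.iterate_succ_apply']

/-- A singular simplex lies in a subset. -/
def LiesIn {j : ℕ} (A : Set X) (σ : C(Splx j, X)) : Prop := ∀ x, σ x ∈ A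

/-- The pulled-back cover of the simplex has a Lebesgue number, and the mesh of the subdivided
identity simplex, at most (j / (j + 1))^N, drops below it. -/
theorem exists_sd_small_of_mesh {j : ℕ} {A : Set X} {U : Bool → Set X} (hU : ∀ b, IsOpen (U b))
    (σ : C(Splx (j + 1), X)) (hσ : LiesIn A σ) (hA : A ⊆ ⋃ b, U b) :
    ∃ N₀, ∀ N ≥ N₀, ∀ τ ∈ ((sd (j + 1))^[N] (gen σ)).support, ∃ b, LiesIn (A ∩ U b) τ := by
  obtain ⟨δ, hδ, h⟩ := lebesgue_number_lemma_of_metric (s := (Set.univ : Set (Splx (j + 1))))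
    (c := fun b => σ ⁻¹' U b) isCompact_univ (fun b => (hU b).preimage σ.continuous)
    (fun x _ => by simpa using hA (hσ x))
  have hlt : (j : ℝ) / (j + 1) < 1 := by
    rw [div_lt_one (by positivity)]; linarith
  obtain ⟨N₀, hN₀⟩ := exists_pow_lt_of_lt_one hδ hlt
  refine ⟨N₀, fun N hN τ hτ => ?_⟩
  rw [gen_eq_push, sd_iterate_push] at hτ
  obtain ⟨ρ, hρ, rfl⟩ := support_push _ _ hτ
  obtain ⟨b, hb⟩ := h (ρ (Classical.arbitrary _)) (Set.mem_univ _)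
  refine ⟨b, fun x => ⟨hσ _, hb ?_⟩⟩
  rw [Metric.mem_ball, Subtype.dist_eq, dist_eq_norm]
  exact ((affineMesh_sd_iterate j N ρ hρ).norm_sub_le _ _).trans_lt
    ((pow_le_pow_of_le_one (by positivity) hlt.le hN).trans_lt hN₀)

end small

/-! ### Chains supported in a subset, and Mayer–Vietoris -/

section supported
variable {X Y : Type} [TopologicalSpace X] [TopologicalSpace Y]

/-- The chains whose simplices lie in `A`. -/
def Supp (A : Set X) (j : ℕ) : Submodule ℤ (Chain j X) := Finsupp.supported ℤ ℤ {σ | LiesIn A σ}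

theorem mem_Supp {A : Set X} {j : ℕ} {c : Chain j X} :
    c ∈ Supp A j ↔ ∀ σ ∈ c.support, LiesIn A σ := Iff.rfl

theorem Supp_mono {A B : Set X} (h : A ⊆ B) (j : ℕ) : Supp A j ≤ Supp B j :=
  fun _ hc _ hσ x => h (hc hσ x)

theorem mem_Supp_inter {A B : Set X} {j : ℕ} {c : Chain j X} (hA : c ∈ Supp A j)
    (hB : c ∈ Supp B j) : c ∈ Supp (A ∩ B) j :=
  fun _ hσ x => ⟨hA hσ x, hB hσ x⟩

theorem gen_mem_Supp {A : Set X} {j : ℕ} {σ : C(Splx j, X)} (h : LiesIn A σ) :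
    gen σ ∈ Supp A j :=
  fun _ hτ => support_gen hτ ▸ h

theorem extend_mem {A : Set X} {j : ℕ} {M : Type*} [AddCommGroup M] {N : Submodule ℤ M}
    {f : C(Splx j, X) → M} (hf : ∀ σ, LiesIn A σ → f σ ∈ N) {c : Chain j X} (hc : c ∈ Supp A j) :
    extend f c ∈ N := by
  rw [extend, Finsupp.linearCombination_apply]
  exact N.sum_mem fun σ hσ => N.smul_mem (c σ) (hf σ (hc hσ))

theorem push_mem {A : Set X} {B : Set Y} {f : C(X, Y)} (hf : Set.MapsTo f A B) {j : ℕ}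
    {c : Chain j X} (hc : c ∈ Supp A j) : push f j c ∈ Supp B j :=
  extend_mem (fun _ hσ => gen_mem_Supp fun x => hf (hσ x)) hc

theorem push_mem_of_liesIn {A : Set Y} {f : C(X, Y)} (hf : ∀ x, f x ∈ A) {j : ℕ}
    (c : Chain j X) : push f j c ∈ Supp A j :=
  push_mem (A := Set.univ) (fun x _ => hf x) fun _ _ _ => trivial

theorem bd_mem {A : Set X} {j : ℕ} {c : Chain (j + 1) X} (hc : c ∈ Supp A (j + 1)) :
    bd j c ∈ Supp A j := by
  refine extend_mem (fun σ hσ => ?_) hc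
  refine Submodule.sum_mem _ fun i _ => ?_
  exact (Supp A j).smul_mem ((-1 : ℤ) ^ (i : ℕ)) (gen_mem_Supp fun x => hσ (face i x))

theorem sd_mem {A : Set X} {j : ℕ} {c : Chain j X} (hc : c ∈ Supp A j) : sd j c ∈ Supp A j :=
  extend_mem (fun _ hσ => push_mem_of_liesIn hσ _) hc

theorem ht_mem {A : Set X} {j : ℕ} {c : Chain j X} (hc : c ∈ Supp A j) :
    ht j c ∈ Supp A (j + 1) :=
  extend_mem (fun _ hσ => push_mem_of_liesIn hσ _) hc

/-- The iterated barycentric subdivision. -/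
def sdPow (N j : ℕ) : Chain j X →ₗ[ℤ] Chain j X := sd j ^ N

theorem sdPow_apply (N j : ℕ) (c : Chain j X) : sdPow N j c = (sd j)^[N] c := by
  rw [sdPow, Module.End.pow_apply]

theorem sdPow_succ (N j : ℕ) (c : Chain j X) : sdPow (N + 1) j c = sd j (sdPow N j c) := by
  simp only [sdPow_apply, Function.iterate_succ_apply']

theorem sdPow_mem {A : Set X} {j : ℕ} (N : ℕ) {c : Chain j X} (hc : c ∈ Supp A j) :
    sdPow N j c ∈ Supp A j := by
  induction N with
  | zero => exact hc
  | succ N ih => rw [sdPow_succ]; exact sd_mem ih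

theorem bd_sdPow {j : ℕ} (N : ℕ) (c : Chain (j + 1) X) :
    bd j (sdPow N (j + 1) c) = sdPow N j (bd j c) := by
  induction N with
  | zero => rfl
  | succ N ih => rw [sdPow_succ, sdPow_succ, bd_sd, ih]

/-- The chain `c` is the boundary of a chain in `A`. -/
def Bounds (A : Set X) {j : ℕ} (c : Chain j X) : Prop := ∃ w ∈ Supp A (j + 1), bd j w = c

theorem Bounds.add {A : Set X} {j : ℕ} {c d : Chain j X} (hc : Bounds A c) (hd : Bounds A d) :
    Bounds A (c + d) := by
  obtain ⟨w, hw, rfl⟩ := hc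
  obtain ⟨v, hv, rfl⟩ := hd
  exact ⟨w + v, Submodule.add_mem _ hw hv, map_add _ _ _⟩

theorem Bounds.mono {A B : Set X} (h : A ⊆ B) {j : ℕ} {c : Chain j X} (hc : Bounds A c) :
    Bounds B c :=
  let ⟨w, hw, e⟩ := hc
  ⟨w, Supp_mono h _ hw, e⟩

theorem bounds_sub_sdPow {A : Set X} {j : ℕ} (N : ℕ) {c : Chain (j + 1) X}
    (hc : c ∈ Supp A (j + 1)) (h : bd j c = 0) : Bounds A (c - sdPow N (j + 1) c) := by
  induction N with
  | zero => exact ⟨0, Submodule.zero_mem _, by simp [sdPow]⟩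
  | succ N ih =>
    have : Bounds A (sdPow N (j + 1) c - sdPow (N + 1) (j + 1) c) :=
      ⟨ht (j + 1) (sdPow N (j + 1) c), ht_mem (sdPow_mem N hc), by
        rw [bd_ht, bd_sdPow, h, sdPow_succ]; simp⟩
    simpa using ih.add this

/-- The reduced homology of `A` in degree `j` vanishes. -/
def Acyclic (A : Set X) (j : ℕ) : Prop := ∀ c ∈ Supp A (j + 1), bd j c = 0 → Bounds A c

theorem exists_sdPow_mem_sup {A U₀ U₁ : Set X} (h₀ : IsOpen U₀) (h₁ : IsOpen U₁) {j : ℕ}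
    {c : Chain (j + 1) X} (hc : c ∈ Supp (A ∩ (U₀ ∪ U₁)) (j + 1)) :
    ∃ N, sdPow N (j + 1) c ∈ Supp (A ∩ U₀) (j + 1) ⊔ Supp (A ∩ U₁) (j + 1) := by
  have key : ∀ σ : C(Splx (j + 1), X), ∃ N₀, LiesIn (A ∩ (U₀ ∪ U₁)) σ → ∀ N ≥ N₀,
      sdPow N (j + 1) (gen σ) ∈ Supp (A ∩ U₀) (j + 1) ⊔ Supp (A ∩ U₁) (j + 1) := by
    intro σ
    by_cases hσ : LiesIn (A ∩ (U₀ ∪ U₁)) σ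
    swap
    · exact ⟨0, fun h => (hσ h).elim⟩
    obtain ⟨N₀, hN⟩ := exists_sd_small_of_mesh (A := A ∩ (U₀ ∪ U₁))
      (U := fun b => cond b U₀ U₁) (by rintro ⟨⟩ <;> assumption) σ hσ
      (fun x hx => by simpa [Set.mem_iUnion, or_comm] using hx.2)
    refine ⟨N₀, fun _ N hN' => ?_⟩
    rw [sdPow_apply, ← Finsupp.sum_single ((sd (j + 1))^[N] (gen σ))]
    refine Submodule.sum_mem _ fun τ hτ => ?_
    have hs : Finsupp.single τ (((sd (j + 1))^[N] (gen σ)) τ) =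
        (((sd (j + 1))^[N] (gen σ)) τ) • gen τ := by simp [gen]
    rw [hs]
    refine Submodule.smul_mem _ _ ?_
    obtain ⟨b, hb⟩ := hN N hN' τ hτ
    cases b
    · exact Submodule.mem_sup_right (gen_mem_Supp fun x => ⟨(hb x).1.1, (hb x).2⟩)
    · exact Submodule.mem_sup_left (gen_mem_Supp fun x => ⟨(hb x).1.1, (hb x).2⟩)
  choose N₀ hN₀ using key
  -- Every larger number of subdivisions also works for a given simplex, so the maximum over the
  -- finite support serves all of them.
  refine ⟨c.support.sup N₀, ?_⟩
  suffices h : sdPow (c.support.sup N₀) (j + 1) (c.sum Finsupp.single) ∈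
      Supp (A ∩ U₀) (j + 1) ⊔ Supp (A ∩ U₁) (j + 1) by rwa [Finsupp.sum_single] at h
  rw [Finsupp.sum, map_sum]
  refine Submodule.sum_mem _ fun σ hσ => ?_
  have hs : Finsupp.single σ (c σ) = c σ • gen σ := by simp [gen]
  rw [hs, map_zsmul]
  exact Submodule.smul_mem _ _ (hN₀ σ (hc hσ) _ (Finset.le_sup hσ))

/-- The injectivity part of Mayer–Vietoris: the difference of the two bounding chains is a cycle in
the union, and a chain it bounds is used to correct them until they agree. -/
theorem bounds_inter {A U₀ U₁ : Set X} (h₀ : IsOpen U₀) (h₁ : IsOpen U₁) {j : ℕ}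
    (hA : Acyclic (A ∩ (U₀ ∪ U₁)) (j + 1)) {c : Chain (j + 1) X}
    (hc : c ∈ Supp (A ∩ (U₀ ∩ U₁)) (j + 1)) (hz : bd j c = 0) (hc₀ : Bounds (A ∩ U₀) c)
    (hc₁ : Bounds (A ∩ U₁) c) : Bounds (A ∩ (U₀ ∩ U₁)) c := by
  obtain ⟨w₀, hw₀, e₀⟩ := hc₀
  obtain ⟨w₁, hw₁, e₁⟩ := hc₁
  have hl : A ∩ U₀ ⊆ A ∩ (U₀ ∪ U₁) := Set.inter_subset_inter_right _ Set.subset_union_left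
  have hr : A ∩ U₁ ⊆ A ∩ (U₀ ∪ U₁) := Set.inter_subset_inter_right _ Set.subset_union_right
  obtain ⟨u, hu, eu⟩ := hA (w₀ - w₁)
    (Submodule.sub_mem _ (Supp_mono hl _ hw₀) (Supp_mono hr _ hw₁)) (by rw [map_sub, e₀, e₁, sub_self])
  obtain ⟨N, hN⟩ := exists_sdPow_mem_sup h₀ h₁ hu
  obtain ⟨u₀, hu₀, u₁, hu₁, e⟩ := Submodule.mem_sup.1 hN
  -- The left side lies in `U₀` and the right side in `U₁`, so this common chain lies in the
  -- intersection; its boundary is the subdivided `c`.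
  have heq : sdPow N _ w₀ - bd _ u₀ = sdPow N _ w₁ + bd _ u₁ := by
    have : sdPow N _ (w₀ - w₁) = bd _ (u₀ + u₁) := by rw [e, bd_sdPow, eu]
    rw [map_sub, map_add] at this
    rw [sub_eq_iff_eq_add] at this ⊢
    rw [this]; abel
  have h : Bounds (A ∩ (U₀ ∩ U₁)) (sdPow N _ c) := by
    refine ⟨sdPow N _ w₀ - bd _ u₀, ?_, by rw [map_sub, bd_bd, bd_sdPow, e₀, sub_zero]⟩
    rw [Set.inter_inter_distrib_left]
    refine mem_Supp_inter (Submodule.sub_mem _ (sdPow_mem N hw₀) (bd_mem hu₀)) ?_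
    rw [heq]
    exact Submodule.add_mem _ (sdPow_mem N hw₁) (bd_mem hu₁)
  simpa using (bounds_sub_sdPow N hc hz).add h

/-- After subdivision a cycle splits as `z₀ + z₁`. The boundary of `z₀` is a cycle in the
intersection; filling it by `d` gives the cycles `z₀ - d` and `z₁ + d`, one in each piece. -/
theorem acyclic_union {A U₀ U₁ : Set X} (h₀ : IsOpen U₀) (h₁ : IsOpen U₁) {j : ℕ}
    (hA₀ : Acyclic (A ∩ U₀) (j + 1)) (hA₁ : Acyclic (A ∩ U₁) (j + 1))
    (hA : Acyclic (A ∩ (U₀ ∩ U₁)) j) : Acyclic (A ∩ (U₀ ∪ U₁)) (j + 1) := by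
  intro z hz ez
  have hl : A ∩ U₀ ⊆ A ∩ (U₀ ∪ U₁) := Set.inter_subset_inter_right _ Set.subset_union_left
  have hr : A ∩ U₁ ⊆ A ∩ (U₀ ∪ U₁) := Set.inter_subset_inter_right _ Set.subset_union_right
  obtain ⟨N, hN⟩ := exists_sdPow_mem_sup h₀ h₁ hz
  obtain ⟨z₀, hz₀, z₁, hz₁, e⟩ := Submodule.mem_sup.1 hN
  have hb : bd _ z₀ = -bd _ z₁ := by
    rw [eq_neg_iff_add_eq_zero, ← map_add, e, bd_sdPow, ez, map_zero]
  obtain ⟨d, hd, ed⟩ := hA (bd _ z₀) (by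
    rw [Set.inter_inter_distrib_left]
    refine mem_Supp_inter (bd_mem hz₀) ?_
    rw [hb]
    exact Submodule.neg_mem _ (bd_mem hz₁)) (bd_bd _)
  have hd₀ : d ∈ Supp (A ∩ U₀) _ :=
    Supp_mono (Set.inter_subset_inter_right _ Set.inter_subset_left) _ hd
  have hd₁ : d ∈ Supp (A ∩ U₁) _ :=
    Supp_mono (Set.inter_subset_inter_right _ Set.inter_subset_right) _ hd
  have b₀ := hA₀ (z₀ - d) (Submodule.sub_mem _ hz₀ hd₀) (by rw [map_sub, ed, sub_self])
  have b₁ := hA₁ (z₁ + d) (Submodule.add_mem _ hz₁ hd₁) (by rw [map_add, ed, hb]; simp)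
  have b := ((b₀.mono hl).add (b₁.mono hr)).add (bounds_sub_sdPow N hz ez)
  rwa [sub_add_add_cancel, e, add_sub_cancel] at b

/-- The inclusion of a subset. -/
abbrev incl (A : Set X) : C(A, X) := ⟨Subtype.val, continuous_subtype_val⟩

theorem exists_push_incl {A : Set X} {j : ℕ} {c : Chain j X} (hc : c ∈ Supp A j) :
    ∃ c' : Chain j A, push (incl A) j c' = c := by
  have : c ∈ LinearMap.range (push (incl A) j) := by
    have h := extend_mem (N := LinearMap.range (push (incl A) j)) (f := fun σ => gen σ)
      (fun σ hσ => ⟨gen ⟨fun x => ⟨σ x, hσ x⟩, σ.continuous.subtype_mk _⟩, by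
        rw [push_gen]; rfl⟩) hc
    have e : (extend fun σ => gen σ : Chain j X →ₗ[ℤ] Chain j X) = LinearMap.id :=
      chain_hom_ext fun σ => by simp
    rwa [e] at h
  exact this

/-- A cone from any point fills a cycle. The empty set is allowed because only degrees at least 0
occur, where it has no simplices. -/
theorem acyclic_of_convex {V : Type} [NormedAddCommGroup V] [NormedSpace ℝ V] {A : Set V}
    (hA : Convex ℝ A) (j : ℕ) : Acyclic A j := by
  intro c hc h
  obtain ⟨c', rfl⟩ := exists_push_incl hc
  rw [bd_push] at h
  have h' : bd j c' = 0 := push_injective _ Subtype.val_injective _ (by rw [h, map_zero])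
  rcases A.eq_empty_or_nonempty with rfl | ⟨b, hb⟩
  · refine ⟨0, Submodule.zero_mem _, ?_⟩
    have : IsEmpty C(Splx (j + 1), (∅ : Set V)) := ⟨fun σ => (σ (bary j)).2⟩
    rw [map_zero, Subsingleton.elim c' 0, map_zero]
  · refine ⟨push (incl A) _ (cone hA ⟨b, hb⟩ _ c'), push_mem_of_liesIn (fun x => x.2) _, ?_⟩
    rw [bd_push, bd_cone, h', map_zero, sub_zero]

/-- A convex set intersected with a union of `r` open convex sets has vanishing reduced homology
in degrees at least `r - 1`. -/
theorem acyclic_inter_union {V : Type} [NormedAddCommGroup V] [NormedSpace ℝ V]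
    (l : List (Set V)) (hl : ∀ O ∈ l, IsOpen O ∧ Convex ℝ O) {A : Set V} (hA : Convex ℝ A) {j : ℕ}
    (hj : l.length ≤ j + 1) : Acyclic (A ∩ ⋃ O ∈ l, O) j := by
  induction l generalizing A j with
  | nil => simpa using acyclic_of_convex convex_empty j
  | cons O l ih =>
    have hO := hl O List.mem_cons_self
    have hl' : ∀ O ∈ l, IsOpen O ∧ Convex ℝ O := fun P hP => hl P (List.mem_cons_of_mem _ hP)
    have e : (⋃ P ∈ O :: l, P) = O ∪ ⋃ P ∈ l, P := by simp [Set.iUnion_or, Set.iUnion_union_distrib]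
    rw [e]
    rw [List.length_cons, Nat.add_le_add_iff_right] at hj
    cases j with
    | zero =>
      rw [Nat.le_zero, List.length_eq_zero_iff] at hj
      subst hj
      simpa using acyclic_of_convex (hA.inter hO.2) 0
    | succ j =>
      refine acyclic_union hO.1 (isOpen_biUnion fun P hP => (hl' P hP).1)
        (acyclic_of_convex (hA.inter hO.2) _) (ih hl' hA (by omega)) ?_
      -- The intersection term is the same statement for the convex set `A ∩ O`, with one open set
      -- fewer and one degree lower.
      rw [← Set.inter_assoc]
      exact ih hl' (hA.inter hO.2) hj

end supported

theorem exists_ball_of_chain {j : ℕ} {V : Type} [NormedAddCommGroup V] (c : Chain j V) : ∃ R, c ∈ Supp (Metric.ball (0 : V) R) j := by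
  have h : Bornology.IsBounded (⋃ σ ∈ c.support, Set.range σ) :=
    (Bornology.isBounded_biUnion c.support.finite_toSet).2 fun σ _ =>
      (isCompact_range σ.continuous).isBounded
  obtain ⟨R, hR⟩ := h.subset_ball 0
  exact ⟨R, fun σ hσ x => hR (Set.mem_biUnion hσ ⟨x, rfl⟩)⟩

/-! ### Complements of affine subspaces -/

section arrangement
variable {V : Type} [NormedAddCommGroup V] [NormedSpace ℝ V]

theorem compl_biUnion_cons (M : AffineSubspace ℝ V) (l : List (AffineSubspace ℝ V)) :
    (⋃ N ∈ M :: l, (N : Set V))ᶜ = (M : Set V)ᶜ ∩ (⋃ N ∈ l, (N : Set V))ᶜ := by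
  simp [Set.iUnion_or, Set.iUnion_union_distrib]

/-- The union term of Mayer–Vietoris is thus again the complement of an arrangement, with as many
members as `l`. -/
theorem compl_union_compl_biUnion (M : AffineSubspace ℝ V) (l : List (AffineSubspace ℝ V)) :
    (M : Set V)ᶜ ∪ (⋃ N ∈ l, (N : Set V))ᶜ = (⋃ N ∈ l.map (M ⊓ ·), (N : Set V))ᶜ := by
  rw [← Set.compl_inter, Set.inter_iUnion₂]
  congr 1
  ext x
  simp [AffineSubspace.mem_inf_iff]

variable [FiniteDimensional ℝ V]

theorem exists_functionals (E D : Submodule ℝ V) :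
    ∃ f : Fin (Module.finrank ℝ (E ⧸ D.submoduleOf E)) → V →L[ℝ] ℝ,
      ∀ x ∈ E, x ∈ D ↔ ∀ i, f i x = 0 := by
  let b := Module.finBasis ℝ (E ⧸ D.submoduleOf E)
  have h : ∀ i, ∃ f : V →ₗ[ℝ] ℝ, f ∘ₗ E.subtype = b.coord i ∘ₗ (D.submoduleOf E).mkQ := fun i =>
    LinearMap.exists_extend _
  choose f hf using h
  refine ⟨fun i => LinearMap.toContinuousLinearMap (f i), fun x hx => ?_⟩
  have hfx : ∀ i, f i x = b.coord i ((D.submoduleOf E).mkQ ⟨x, hx⟩) := fun i =>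
    LinearMap.congr_fun (hf i) ⟨x, hx⟩
  simp only [LinearMap.coe_toContinuousLinearMap', hfx]
  rw [b.forall_coord_eq_zero_iff, Submodule.mkQ_apply, Submodule.Quotient.mk_eq_zero]
  rfl

/-- With d functionals cutting out `M` in `L`, a point is off `M` exactly when some functional
exceeds its value at `p` or their sum falls below its value at `p`. These d + 1 open half-spaces
give acyclicity from degree d on. -/
theorem acyclic_inter_compl {A : Set V} (hA : Convex ℝ A) {L M : AffineSubspace ℝ V}
    (hAL : A ⊆ L) {p : V} (hpL : p ∈ L) (hpM : p ∈ M) {j : ℕ}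
    (hj : Module.finrank ℝ (L.direction ⧸ M.direction.submoduleOf L.direction) ≤ j) :
    Acyclic (A ∩ (M : Set V)ᶜ) j := by
  obtain ⟨f, hf⟩ := exists_functionals L.direction M.direction
  let l : List (Set V) := {x | ∑ i, f i x < ∑ i, f i p} ::
    List.ofFn fun i => {x | f i p < f i x}
  have hl : ∀ O ∈ l, IsOpen O ∧ Convex ℝ O := by
    intro O hO
    rcases List.mem_cons.1 hO with rfl | hO
    · have hs : ∀ x, ∑ i, f i x = (∑ i, f i) x := fun x => by simp
      simp only [hs]
      exact ⟨isOpen_lt (∑ i, f i).continuous continuous_const,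
        convex_halfSpace_lt (∑ i, f i).toLinearMap.isLinear _⟩
    · obtain ⟨i, rfl⟩ := (List.mem_ofFn' _ _).1 hO
      exact ⟨isOpen_lt continuous_const (f i).continuous,
        convex_halfSpace_gt (f i).toLinearMap.isLinear _⟩
  have e : A ∩ (M : Set V)ᶜ = A ∩ ⋃ O ∈ l, O := by
    ext x
    refine and_congr_right fun hx => ?_
    have hM : x ∈ M ↔ ∀ i, f i x = f i p := by
      rw [← AffineSubspace.vsub_right_mem_direction_iff_mem hpM, hf _
        (AffineSubspace.vsub_mem_direction (hAL hx) hpL)]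
      simp [sub_eq_zero]
    have hU : (x ∈ ⋃ O ∈ l, O) ↔ ∑ i, f i x < ∑ i, f i p ∨ ∃ i, f i p < f i x := by
      simp [l, Set.iUnion_or, Set.iUnion_union_distrib, List.mem_ofFn']
    rw [hU, Set.mem_compl_iff, SetLike.mem_coe, hM, ← not_iff_not]
    push Not
    constructor
    · intro h
      simp [h]
    · rintro ⟨h₁, h₂⟩ i
      exact (Finset.sum_eq_sum_iff_of_le fun i _ => h₂ i).1
        (le_antisymm (Finset.sum_le_sum fun i _ => h₂ i) h₁) i (Finset.mem_univ i)
  rw [e]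
  exact acyclic_inter_union l hl hA (by simpa [l] using hj)

theorem isOpen_compl_affineSubspace (M : AffineSubspace ℝ V) : IsOpen (M : Set V)ᶜ :=
  (AffineSubspace.closed_of_finiteDimensional M).isOpen_compl

theorem isOpen_compl_biUnion (l : List (AffineSubspace ℝ V)) :
    IsOpen (⋃ M ∈ l, (M : Set V))ᶜ :=
  (l.finite_toSet.isClosed_biUnion fun M _ =>
    AffineSubspace.closed_of_finiteDimensional M).isOpen_compl

/-- The complement of a finite union of affine subspaces in a convex subset of an affine subspace
of dimension `d` has vanishing reduced homology in degrees at least `d`. -/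
theorem acyclic_inter_compl_biUnion {A : Set V} (hA : Convex ℝ A) {L : AffineSubspace ℝ V}
    (hAL : A ⊆ L) (l : List (AffineSubspace ℝ V)) {j : ℕ} (hj : Module.finrank ℝ L.direction ≤ j) :
    Acyclic (A ∩ (⋃ M ∈ l, (M : Set V))ᶜ) j := by
  -- Induction on the length rather than the list: the union term involves the list of intersections
  -- with `M`, which is not a sublist.
  induction hr : l.length generalizing l j with
  | zero =>
    rw [List.length_eq_zero_iff] at hr
    subst hr
    simpa using acyclic_of_convex hA j
  | succ r ih =>
    obtain ⟨M, l, rfl⟩ := List.exists_cons_of_length_eq_add_one hr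
    rw [List.length_cons, Nat.add_right_cancel_iff] at hr
    have hM : Acyclic (A ∩ (M : Set V)ᶜ) j := by
      by_cases h : ∃ p, p ∈ L ∧ p ∈ M
      · obtain ⟨p, hpL, hpM⟩ := h
        exact acyclic_inter_compl hA hAL hpL hpM ((Submodule.finrank_quotient_le _).trans hj)
      · have : A ∩ (M : Set V)ᶜ = A :=
          Set.inter_eq_left.2 fun x hx hxM => h ⟨x, hAL hx, hxM⟩
        rw [this]
        exact acyclic_of_convex hA j
    rw [compl_biUnion_cons]
    intro c hc hz
    refine bounds_inter (isOpen_compl_affineSubspace M) (isOpen_compl_biUnion l) ?_ hc hz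
      (hM c ?_ hz) (ih l hj hr c ?_ hz)
    · rw [compl_union_compl_biUnion]
      exact ih _ (by omega) (by simpa using hr)
    · exact Supp_mono (Set.inter_subset_inter_right _ Set.inter_subset_left) _ hc
    · exact Supp_mono (Set.inter_subset_inter_right _ Set.inter_subset_right) _ hc

theorem push_eq_self {X : Type} [TopologicalSpace X] {A : Set X} {r : C(X, X)}
    (hr : ∀ x ∈ A, r x = x) {j : ℕ} {c : Chain j X} (hc : c ∈ Supp A j) : push r j c = c := by
  have h := extend_mem (N := LinearMap.eqLocus (push r j) LinearMap.id) (f := fun σ => gen σ)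
    (fun σ hσ => by
      rw [LinearMap.mem_eqLocus, push_gen, LinearMap.id_apply]
      congr 1
      exact ContinuousMap.ext fun x => hr _ (hσ x)) hc
  have e : (extend fun σ => gen σ : Chain j X →ₗ[ℤ] Chain j X) = LinearMap.id :=
    chain_hom_ext fun σ => by simp
  rw [e] at h
  exact h

/-- The projection onto an affine subspace along a transverse affine subspace of complementary
dimension. -/
theorem exists_retraction {L M : AffineSubspace ℝ V} {p : V} (hpL : p ∈ L) (hpM : p ∈ M)
    (h : IsCompl L.direction M.direction) :
    ∃ r : C(V, V), (∀ x ∈ L, r x = x) ∧ Set.MapsTo r (M : Set V)ᶜ (L ∩ (M : Set V)ᶜ) := by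
  let q := L.direction.projection M.direction h
  refine ⟨⟨fun x => q (x - p) + p, by
    have := q.continuous_of_finiteDimensional
    fun_prop⟩, fun x hx => ?_, fun x hx => ⟨?_, fun hr => hx ?_⟩⟩
  · have hq : q (x - p) = x - p :=
      Submodule.projection_apply_of_mem_left h (AffineSubspace.vsub_mem_direction hx hpL)
    change q (x - p) + p = x
    rw [hq, sub_add_cancel]
  · exact AffineSubspace.vadd_mem_of_mem_direction (Submodule.projection_apply_mem h _) hpL
  · have h₁ : q (x - p) ∈ M.direction := by
      have := AffineSubspace.vsub_mem_direction hr hpM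
      simpa using this
    have h₂ : q (x - p) = 0 := by
      rw [← Submodule.projection_apply_eq_zero_iff h] at h₁
      rwa [Submodule.projection_apply_of_mem_left h (Submodule.projection_apply_mem h _)] at h₁
    rw [Submodule.projection_apply_eq_zero_iff h] at h₂
    exact (AffineSubspace.vsub_right_mem_direction_iff_mem hpM x).1 h₂

/-- A `k`-cycle in an open convex part of a `(k + 1)`-dimensional affine subspace `L`, off an affine
subspace `M` of codimension `k + 1`, bounds there as soon as it bounds off `M`. -/
theorem bounds_inter_compl {L M : AffineSubspace ℝ V} {k : ℕ}
    (hL : Module.finrank ℝ L.direction = k + 1) (hM : HasCodim M (k + 1)) {U : Set V}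
    (hU : IsOpen U) (hU' : Convex ℝ U) {c : Chain (k + 1) V}
    (hc : c ∈ Supp (L ∩ (U ∩ (M : Set V)ᶜ)) (k + 1)) (hz : bd k c = 0)
    (hcM : Bounds (M : Set V)ᶜ c) : Bounds (L ∩ (U ∩ (M : Set V)ᶜ)) c := by
  have hA : Convex ℝ (L ∩ U : Set V) := L.convex.inter hU'
  have hdisj : (∀ x ∈ (L ∩ U : Set V), x ∉ M) → Bounds (L ∩ (U ∩ (M : Set V)ᶜ)) c := by
    intro h
    have e : (L ∩ (U ∩ (M : Set V)ᶜ) : Set V) = (L : Set V) ∩ U := by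
      rw [← Set.inter_assoc]
      exact Set.inter_eq_left.2 h
    rw [e] at hc ⊢
    exact acyclic_of_convex hA k c hc hz
  by_cases h : ∃ p, p ∈ L ∧ p ∈ M
  swap
  · exact hdisj fun x hx hxM => h ⟨x, hx.1, hxM⟩
  obtain ⟨p, hpL, hpM⟩ := h
  by_cases hE : Disjoint L.direction M.direction
  · have hcompl : IsCompl L.direction M.direction := by
      refine ⟨hE, codisjoint_iff.2 (Submodule.eq_top_of_disjoint _ _ ?_ hE)⟩
      rw [← Submodule.finrank_quotient_add_finrank M.direction, hM.2, hL]
    have hp : ∀ x ∈ L, x ∈ M → x = p := fun x hx hxM =>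
      vsub_eq_zero_iff_eq.1 (Submodule.disjoint_def.1 hE _
        (AffineSubspace.vsub_mem_direction hx hpL) (AffineSubspace.vsub_mem_direction hxM hpM))
    by_cases hpU : p ∈ U
    swap
    · exact hdisj fun x hx hxM => hpU (hp x hx.1 hxM ▸ hx.2)
    obtain ⟨r, hr, hr'⟩ := exists_retraction hpL hpM hcompl
    have hcU : c ∈ Supp (L ∩ U : Set V) (k + 1) :=
      Supp_mono (Set.inter_subset_inter_right _ Set.inter_subset_left) _ hc
    -- Since `p ∈ U`, the sets `U` and the complement of `M` cover `L`, so the union term is convex.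
    -- Off `M`, the bounding chain is pushed into `L` by `r`, which fixes `c`.
    refine bounds_inter hU (isOpen_compl_affineSubspace M) ?_ hc hz
      (acyclic_of_convex hA k c hcU hz) ?_
    · have e : (L ∩ (U ∪ (M : Set V)ᶜ) : Set V) = L := Set.inter_eq_left.2 fun x hx => by
        by_cases hxM : x ∈ M
        · exact Or.inl (hp x hx hxM ▸ hpU)
        · exact Or.inr hxM
      rw [e]
      exact acyclic_of_convex L.convex _
    · obtain ⟨w, hw, ew⟩ := hcM
      exact ⟨push r _ w, push_mem hr' hw, by
        rw [bd_push, ew, push_eq_self hr (Supp_mono Set.inter_subset_left _ hc)]⟩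
  -- The directions share a nonzero vector, so `M` cuts out codimension at most `k` in `L`.
  · rw [← Set.inter_assoc] at hc ⊢
    refine acyclic_inter_compl hA Set.inter_subset_left hpL hpM ?_ c hc hz
    have hne : 0 < Module.finrank ℝ (M.direction.submoduleOf L.direction) := by
      rw [Module.finrank_pos_iff_of_free, Submodule.nontrivial_iff_ne_bot]
      intro hbot
      exact hE (Submodule.disjoint_iff_comap_eq_bot.2 hbot)
    have := Submodule.finrank_quotient_add_finrank (M.direction.submoduleOf L.direction)
    omega

/-- Members are split off one at a time; the obstruction to combining two bounding chains lies in
degree k + 1 = dim L, where arrangement complements in `L ∩ U` are acyclic. -/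
theorem bounds_inter_compl_biUnion {L : AffineSubspace ℝ V} {k : ℕ}
    (hL : Module.finrank ℝ L.direction = k + 1) {U : Set V}
    (hU : IsOpen U) (hU' : Convex ℝ U) (l : List (AffineSubspace ℝ V))
    (hl : ∀ M ∈ l, HasCodim M (k + 1)) {c : Chain (k + 1) V}
    (hc : c ∈ Supp (L ∩ U ∩ (⋃ M ∈ l, (M : Set V))ᶜ) (k + 1)) (hz : bd k c = 0)
    (hcl : ∀ M ∈ l, Bounds (M : Set V)ᶜ c) : Bounds (L ∩ U ∩ (⋃ M ∈ l, (M : Set V))ᶜ) c := by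
  have hA : Convex ℝ (L ∩ U : Set V) := L.convex.inter hU'
  induction l with
  | nil =>
    simp only [List.not_mem_nil, Set.iUnion_of_empty, Set.iUnion_empty, Set.compl_empty,
      Set.inter_univ] at hc ⊢
    exact acyclic_of_convex hA k c hc hz
  | cons M l ih =>
    have hM := hl M List.mem_cons_self
    rw [compl_biUnion_cons] at hc ⊢
    have hc₀ := Supp_mono (Set.inter_subset_inter_right _ Set.inter_subset_left) _ hc
    have hc₁ := Supp_mono (Set.inter_subset_inter_right _ Set.inter_subset_right) _ hc
    refine bounds_inter (isOpen_compl_affineSubspace M) (isOpen_compl_biUnion l) ?_ hc hz ?_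
      (ih (fun N hN => hl N (List.mem_cons_of_mem _ hN)) hc₁
        fun N hN => hcl N (List.mem_cons_of_mem _ hN))
    · rw [compl_union_compl_biUnion]
      exact acyclic_inter_compl_biUnion hA Set.inter_subset_left _ hL.le
    · rw [Set.inter_assoc] at hc₀ ⊢
      exact bounds_inter_compl hL hM hU hU' hc₀ hz (hcl M List.mem_cons_self)

theorem bounds_inter_compl_of_isLocallyFinite {k : ℕ} {S : Set (AffineSubspace ℝ V)}
    (hS : IsLocallyFinite S) (hcodim : ∀ M ∈ S, HasCodim M (k + 1)) {L : AffineSubspace ℝ V}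
    (hL : Module.finrank ℝ L.direction = k + 1) {c : Chain (k + 1) V}
    (hc : c ∈ Supp (L ∩ (⋃ M ∈ S, (M : Set V))ᶜ) (k + 1)) (hz : bd k c = 0)
    (hb : Bounds (⋃ M ∈ S, (M : Set V))ᶜ c) : Bounds (L ∩ (⋃ M ∈ S, (M : Set V))ᶜ) c := by
  obtain ⟨R, hR⟩ := exists_ball_of_chain c
  have hc' := mem_Supp.1 hc
  have hfin := hS _ (isCompact_closedBall (0 : V) R)
  have hmem : ∀ M, M ∈ hfin.toFinset.toList ↔
      M ∈ S ∧ ((M : Set V) ∩ Metric.closedBall 0 R).Nonempty := fun M => by simp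
  -- Only `c` has to lie in the ball: the given bounding chain may leave it, being used only as a
  -- chain off each single `M`.
  have hb' := bounds_inter_compl_biUnion hL Metric.isOpen_ball (convex_ball (0 : V) R)
    hfin.toFinset.toList (c := c) (fun M hM => hcodim M ((hmem M).1 hM).1) ?_ hz ?_
  · refine Bounds.mono (fun x hx => ?_) hb'
    refine ⟨hx.1.1, fun hxS => hx.2 ?_⟩
    obtain ⟨M, hM, hxM⟩ := Set.mem_iUnion₂.1 hxS
    exact Set.mem_biUnion ((hmem M).2 ⟨hM, x, hxM, Metric.ball_subset_closedBall hx.1.2⟩) hxM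
  · rw [mem_Supp]
    intro σ hσ x
    refine ⟨⟨(hc' σ hσ x).1, hR hσ x⟩, fun hx => (hc' σ hσ x).2 ?_⟩
    obtain ⟨M, hM, hxM⟩ := Set.mem_iUnion₂.1 hx
    exact Set.mem_biUnion ((hmem M).1 hM).1 hxM
  · exact fun M hM => hb.mono (Set.compl_subset_compl.2 (Set.subset_biUnion_of_mem
      (u := fun M : AffineSubspace ℝ V => (M : Set V)) ((hmem M).1 hM).1))

end arrangement

/-! ### Homology classes as cycles modulo boundaries -/

section chainComplex
variable {K K' : ChainComplex (ModuleCat.{0} ℤ) ℕ} {k : ℕ}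

theorem homologyπ_surjective (h : K.homology k) : ∃ y : K.cycles k, K.homologyπ k y = h :=
  (ModuleCat.epi_iff_surjective _).1 inferInstance h

theorem homologyπ_eq_zero_iff (y : K.cycles k) :
    K.homologyπ k y = 0 ↔ ∃ w : K.X (k + 1), K.d (k + 1) k w = K.iCycles k y := by
  have hex : (ShortComplex.mk (K.toCycles (k + 1) k) (K.homologyπ k)
      (K.toCycles_comp_homologyπ _ _)).Exact :=
    ShortComplex.exact_of_g_is_cokernel _ (K.homologyIsCokernel (k + 1) k (by simp))
  have hi : ∀ w, K.iCycles k (K.toCycles (k + 1) k w) = K.d (k + 1) k w := fun w => by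
    rw [← ModuleCat.comp_apply, K.toCycles_i]
  constructor
  · intro h
    obtain ⟨w, hw⟩ := (ShortComplex.moduleCat_exact_iff _).1 hex y h
    exact ⟨w, by rw [← hi]; exact congrArg _ hw⟩
  · rintro ⟨w, hw⟩
    have : K.toCycles (k + 1) k w = y :=
      (ModuleCat.mono_iff_injective (K.iCycles k)).1 inferInstance (by rw [hi, hw])
    rw [← this]
    exact LinearMap.congr_fun (congrArg ModuleCat.Hom.hom (K.toCycles_comp_homologyπ (k + 1) k)) w

theorem homologyMap_homologyπ (f : K ⟶ K') (y : K.cycles k) :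
    HomologicalComplex.homologyMap f k (K.homologyπ k y) =
      K'.homologyπ k (HomologicalComplex.cyclesMap f k y) := by
  rw [← ModuleCat.comp_apply, HomologicalComplex.homologyπ_naturality, ModuleCat.comp_apply]

theorem iCycles_cyclesMap (f : K ⟶ K') (y : K.cycles k) :
    K'.iCycles k (HomologicalComplex.cyclesMap f k y) = f.f k (K.iCycles k y) := by
  rw [← ModuleCat.comp_apply, HomologicalComplex.cyclesMap_i, ModuleCat.comp_apply]

theorem d_iCycles (y : K.cycles (k + 1)) : K.d (k + 1) k (K.iCycles (k + 1) y) = 0 := by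
  rw [← ModuleCat.comp_apply, K.iCycles_d]
  rfl

end chainComplex

/-! ### Comparison with Mathlib's singular homology -/

section comparison

/-- The singular chain complex with integer coefficients. -/
abbrev singularChains (X : TopCat.{0}) : ChainComplex (ModuleCat.{0} ℤ) ℕ :=
  (TopCat.toSSet.obj X).chainComplex (ModuleCat.of ℤ ℤ)

/-- The map of singular chain complexes induced by a continuous map. -/
abbrev singularChainsMap {X Y : TopCat.{0}} (f : X ⟶ Y) : singularChains X ⟶ singularChains Y :=
  SSet.chainComplexMap (TopCat.toSSet.map f) (ModuleCat.of ℤ ℤ)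

variable (X : TopCat.{0}) {Y : TopCat.{0}} (k : ℕ)

/-- The singular simplex of the singular simplicial set given by a continuous map. -/
def toSimplex : (TopCat.toSSet.obj X).obj (Opposite.op (SimplexCategory.mk k)) ≃ C(Splx (k + 1), X) :=
  X.toSSetObjEquiv (Opposite.op (SimplexCategory.mk k))

/-- The comparison from Mathlib's singular chains to finitely supported functions. -/
def toChain : (singularChains X).X k ⟶ ModuleCat.of ℤ (Chain (k + 1) X) :=
  Limits.Cofan.IsColimit.desc ((TopCat.toSSet.obj X).isColimitChainComplexXCofan _ k)
    fun x => ModuleCat.ofHom (LinearMap.toSpanSingleton ℤ _ (gen (toSimplex X k x)))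

theorem ι_toChain (x) : (TopCat.toSSet.obj X).ιChainComplex x ≫ toChain X k =
    ModuleCat.ofHom (LinearMap.toSpanSingleton ℤ _ (gen (toSimplex X k x))) :=
  Limits.Cofan.IsColimit.fac ((TopCat.toSSet.obj X).isColimitChainComplexXCofan _ k) _ x

/-- A homomorphism of abelian groups as a morphism of `ℤ`-modules. -/
def ofAddHom {M N : ModuleCat.{0} ℤ} (f : M →+ N) : M ⟶ N :=
  ModuleCat.ofHom
    { toFun := f
      map_add' := f.map_add
      map_smul' := fun n x => map_intCast_smul f ℤ ℤ n x }

/-- The inverse of `toChain`. -/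
def ofChain : ModuleCat.of ℤ (Chain (k + 1) X) ⟶ (singularChains X).X k :=
  ofAddHom (extend fun σ =>
    ((TopCat.toSSet.obj X).ιChainComplex (R := ModuleCat.of ℤ ℤ) ((toSimplex X k).symm σ)).hom
      (1 : ℤ)).toAddMonoidHom

theorem ofChain_gen (σ : C(Splx (k + 1), X)) : ofChain X k (gen σ) =
    (TopCat.toSSet.obj X).ιChainComplex (R := ModuleCat.of ℤ ℤ) ((toSimplex X k).symm σ) (1 : ℤ) :=
  extend_gen _ _

theorem toChain_ofChain : toChain X k ≫ ofChain X k = 𝟙 _ := by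
  refine SSet.chainComplex_hom_ext fun x => ?_
  rw [← Category.assoc, ι_toChain]
  ext
  have h := ofChain_gen X k (toSimplex X k x)
  rw [Equiv.symm_apply_apply] at h
  simpa using h

theorem ofChain_toChain : ofChain X k ≫ toChain X k = 𝟙 _ := by
  ext1
  refine chain_hom_ext fun σ => ?_
  have := LinearMap.congr_fun (congrArg ModuleCat.Hom.hom (ι_toChain X k ((toSimplex X k).symm σ)))
    (1 : ℤ)
  rw [Equiv.apply_symm_apply] at this
  change toChain X k (ofChain X k (gen σ)) = gen σ
  rw [ofChain_gen]
  simpa using this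

theorem toChain_injective : Function.Injective (toChain X k) := by
  have : IsIso (toChain X k) := ⟨_, toChain_ofChain X k, ofChain_toChain X k⟩
  exact (ModuleCat.mono_iff_injective _).1 inferInstance

theorem toChain_surjective : Function.Surjective (toChain X k) := by
  have : IsIso (toChain X k) := ⟨_, toChain_ofChain X k, ofChain_toChain X k⟩
  exact (ModuleCat.epi_iff_surjective _).1 inferInstance

theorem toSimplex_δ (x : (TopCat.toSSet.obj X).obj (Opposite.op (SimplexCategory.mk (k + 1))))
    (i : Fin (k + 2)) : toSimplex X k ((TopCat.toSSet.obj X).δ i x) =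
      (toSimplex X (k + 1) x).comp (face i) := rfl

theorem d_toChain : (singularChains X).d (k + 1) k ≫ toChain X k =
    toChain X (k + 1) ≫ ModuleCat.ofHom (bd (k + 1)) := by
  refine SSet.chainComplex_hom_ext fun x => ?_
  rw [← Category.assoc, SSet.ιChainComplex_d, ← Category.assoc, ι_toChain, Preadditive.sum_comp]
  simp only [Preadditive.zsmul_comp, ι_toChain]
  ext
  simp [bd_gen, toSimplex_δ]

theorem toChain_d (c : (singularChains X).X (k + 1)) :
    toChain X k ((singularChains X).d (k + 1) k c) = bd (k + 1) (toChain X (k + 1) c) :=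
  LinearMap.congr_fun (congrArg ModuleCat.Hom.hom (d_toChain X k)) c

variable {X}

theorem map_toChain (f : X ⟶ Y) : (singularChainsMap f).f k ≫ toChain Y k =
    toChain X k ≫ ModuleCat.ofHom (push f.hom (k + 1)) := by
  refine SSet.chainComplex_hom_ext fun x => ?_
  rw [← Category.assoc, SSet.ι_chainComplexMap_f, ← Category.assoc, ι_toChain, ι_toChain]
  ext
  simp
  rfl

theorem toChain_map (f : X ⟶ Y) (c : (singularChains X).X k) :
    toChain Y k ((singularChainsMap f).f k c) = push f.hom (k + 1) (toChain X k c) :=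
  LinearMap.congr_fun (congrArg ModuleCat.Hom.hom (map_toChain k f)) c

variable {k}

/-- In positive degree this is the cycle condition. In degree 0, `bd 0` is the augmentation: the
image in the point is a boundary, so its augmentation vanishes, and pushing to the point loses
nothing on `Chain 0`. -/
theorem bd_toChain_iCycles_of_mem_reducedHomology (y : (singularChains X).cycles k)
    (h : ((homology k).map (toPoint X)).hom ((singularChains X).homologyπ k y) = 0) :
    bd k (toChain X k ((singularChains X).iCycles k y)) = 0 := by
  cases k with
  | succ k => rw [← toChain_d, d_iCycles, map_zero]
  | zero =>
    replace h : HomologicalComplex.homologyMap (singularChainsMap (toPoint X)) 0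
      ((singularChains X).homologyπ 0 y) = 0 := h
    rw [homologyMap_homologyπ, homologyπ_eq_zero_iff] at h
    obtain ⟨w, hw⟩ := h
    rw [iCycles_cyclesMap] at hw
    have h' : bd 0 (push (toPoint X).hom 1
        (toChain X 0 ((singularChains X).iCycles 0 y))) = 0 := by
      rw [← toChain_map, ← hw, toChain_d, bd_bd]
    rw [bd_push] at h'
    refine push_injective_of_comp (toPoint X).hom (fun σ τ _ => ?_) (by rw [h', map_zero])
    exact ContinuousMap.ext fun x => isEmptyElim x

/-- Injectivity on reduced homology in terms of chains. -/
theorem reducedHomologyMap_injective {V : Type} [TopologicalSpace V] {A B : Set V} (h : A ⊆ B)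
    (H : ∀ c ∈ Supp A (k + 1), bd k c = 0 → Bounds B c → Bounds A c) :
    Function.Injective (reducedHomologyMap k (inclusion h)) := by
  rw [injective_iff_map_eq_zero]
  rintro ⟨a, ha⟩ h0
  obtain ⟨y, rfl⟩ := homologyπ_surjective (K := singularChains (TopCat.of A)) a
  have hz := bd_toChain_iCycles_of_mem_reducedHomology y ha
  have h1 : HomologicalComplex.homologyMap (singularChainsMap (inclusion h)) k
      ((singularChains (TopCat.of A)).homologyπ k y) = 0 := congrArg Subtype.val h0
  rw [homologyMap_homologyπ, homologyπ_eq_zero_iff] at h1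
  obtain ⟨w, hw⟩ := h1
  rw [iCycles_cyclesMap] at hw
  let c : Chain (k + 1) A := toChain (TopCat.of A) k ((singularChains (TopCat.of A)).iCycles k y)
  have hw' : bd (k + 1) (toChain (TopCat.of B) (k + 1) w) = push (inclusion h).hom (k + 1) c := by
    rw [← toChain_d, hw, toChain_map]
  obtain ⟨u, hu, eu⟩ := H (push (incl A) _ c) (push_mem_of_liesIn (fun x => x.2) c)
    (by rw [bd_push, hz, map_zero])
    ⟨push (incl B) _ (toChain (TopCat.of B) (k + 1) w), push_mem_of_liesIn (fun x => x.2) _, by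
      rw [bd_push, hw', push_push]; rfl⟩
  obtain ⟨u, rfl⟩ := exists_push_incl hu
  rw [bd_push] at eu
  have eu' := push_injective (incl A) Subtype.val_injective _ eu
  obtain ⟨v, rfl⟩ := toChain_surjective (TopCat.of A) (k + 1) u
  exact Subtype.ext ((homologyπ_eq_zero_iff y).2
    ⟨v, toChain_injective _ _ ((toChain_d (TopCat.of A) k v).trans eu')⟩)

end comparison

end HigherConvexity

end

theorem mainTheorem3 (n k : ℕ) (S : Set (AffineSubspace ℝ (EuclideanSpace ℝ (Fin n))))
    (hS : HigherConvexity.IsLocallyFinite S)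
    (hcodim : ∀ M ∈ S, HigherConvexity.HasCodim M (k + 1)) :
    HigherConvexity.IsKConvex k
      (⋃ M ∈ S, (M : Set (EuclideanSpace ℝ (Fin n))))ᶜ := by
  intro L hL
  exact HigherConvexity.reducedHomologyMap_injective _ fun _ hc hz hb =>
    HigherConvexity.bounds_inter_compl_of_isLocallyFinite hS hcodim hL hc hz hb
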